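/- Let $q$ be a real-valued summable function on $[0,\pi]$ ($q\in L^1_{\mathbb R}[0,\pi]$), let $\alpha\in(0,\pi]$ and $\beta\in[0,\pi)$, and let $L(q,\alpha,\beta)$ be the Sturm–Liouville problem $$-y''+q(x)y=\mu y\quad(0<x<\pi),\qquad y(0)\cos\alpha+y'(0)\sin\alpha=0,\qquad y(\pi)\cos\beta+y'(\pi)\sin\beta=0,$$ with $\mu\in\mathbb C$. Here a solution is a function $y:[0,\pi]\to\mathbb C$ that is differentiable with absolutely continuous derivative $y'$ on $[0,\pi]$ and satisfies the equation almost everywhere; $\mu$ is an eigenvalue, and $y$ an eigenfunction for $\mu$, if $y$ is a solution that is not identically zero and satisfies both boundary conditions. All eigenvalues of $L(q,\alpha,\beta)$ are real, and they form a strictly increasing infinite sequence $\mu_0<\mu_1<\dots<\mu_n<\cdots$. For every $n=0,1,2,\dots$, every eigenfunction $y$ for the $n$-th eigenvalue $\mu_n$ has exactly $n$ zeros in $(0,\pi)$, and all of these zeros are simple, i.e. $y'(x)\neq0$ at each of them. If $\alpha=\pi$ and $\beta=0$, then $y$ has exactly $n+2$ zeros in $[0,\pi]$. If either $\alpha=\pi$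 and $\beta\in(0,\pi)$, or $\beta=0$ and $\alpha\in(0,\pi)$, then $y$ has exactly $n+1$ zeros in $[0,\pi]$. -/

import Mathlib

open Real Set MeasureTheory

noncomputable section

namespace SturmLiouville

/-- The derivative `y'` of `y` as a function on `[0, π]`, one-sided at the endpoints. -/
def D (y : ℝ → ℂ) : ℝ → ℂ := derivWithin y (Icc 0 π)

/-- `y` solves `-y'' + q y = μ y` on `(0, π)` in the Carathéodory sense, the usual one for a
summable `q`: `y` is differentiable on `[0, π]`, `y'` is absolutely continuous on `[0, π]`,
and the equation holds almost everywhere. -/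
structure IsSolution (q : ℝ → ℝ) (μ : ℂ) (y : ℝ → ℂ) : Prop where
  differentiableOn : DifferentiableOn ℝ y (Icc 0 π)
  absCont : AbsolutelyContinuousOnInterval (D y) 0 π
  eqn : ∀ᵐ x : ℝ, x ∈ Ioo 0 π →
    ∃ y'' : ℂ, HasDerivAt (D y) y'' x ∧ -y'' + (q x : ℂ) * y x = μ * y x

/-- `y` is an eigenfunction of the problem `L(q, α, β)` for `μ`: a solution, not identically zero
on `[0, π]`, that satisfies both boundary conditions. -/
structure IsEigenfunction (q : ℝ → ℝ) (α β : ℝ) (μ : ℂ) (y : ℝ → ℂ) : Prop where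
  isSolution : IsSolution q μ y
  left : y 0 * (cos α : ℂ) + D y 0 * (sin α : ℂ) = 0
  right : y π * (cos β : ℂ) + D y π * (sin β : ℂ) = 0
  nontrivial : ∃ x ∈ Icc 0 π, y x ≠ 0

/-- `μ ∈ ℂ` is an eigenvalue of `L(q, α, β)`. -/
def IsEigenvalue (q : ℝ → ℝ) (α β : ℝ) (μ : ℂ) : Prop :=
  ∃ y : ℝ → ℂ, IsEigenfunction q α β μ y

/-- `μ 0 < μ 1 < μ 2 < …` is the list of all (complex) eigenvalues of `L(q, α, β)`. -/
structure IsEigenvalueEnumeration (q : ℝ → ℝ) (α β : ℝ) (μ : ℕ → ℝ) : Prop where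
  strictMono : StrictMono μ
  isEigenvalue_iff : ∀ z : ℂ, IsEigenvalue q α β z ↔ ∃ n, z = (μ n : ℂ)

/-- The set of zeros of `y` in `s`. -/
def zeros (y : ℝ → ℂ) (s : Set ℝ) : Set ℝ := {x ∈ s | y x = 0}

end SturmLiouville

end

/-! Prüfer's method. Writing a real solution as `y = r sin θ`, `y' = r cos θ` with `r > 0` turns the
equation into the scalar one `θ' = cos² θ + (μ - q) sin² θ`. The left condition holds for `θ 0 = π -
α`, which lies in `[0, π)`, and the right one becomes `sin (θ π + β) = 0`. Zeros of `y` are the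
points where `θ` is a multiple of `π`.

The difference of two angles solves a linear equation with summable coefficient, so an integrating
factor gives every comparison needed. In `x`, the angle never returns to a multiple of `π` once
reached, although it need not be monotone (`IsAngle.lt_of_le`). In `μ`, the terminal angle is
strictly increasing and continuous (`IsAngle.lt_of_lt`, `IsAngle.abs_sub_le`). It is unbounded above
and comes arbitrarily close to `0` (`exists_le_angle`, `exists_angle_lt`), so it takes each positive
value exactly once.

Eigenvalues are real by the Lagrange identity, hence `μ n` is the parameter with `θ π = (n + 1) π -
β`. This lies in `(n π, (n + 1) π]`, so exactly the multiples `π, …, n π` are met inside, each once.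
At a zero `sin θ = 0` forces `cos θ ≠ 0`, which is simplicity. The endpoints are zeros exactly when
`sin α = 0`, respectively `sin β = 0`. -/

noncomputable section
namespace SturmLiouville

/-! ### Calculus of absolutely continuous functions -/

/-- `f` is absolutely continuous on `[a, b]` with a.e. derivative `f'` in `(a, b)`. -/
structure HasACDeriv (f f' : ℝ → ℝ) (a b : ℝ) : Prop where
  ac : AbsolutelyContinuousOnInterval f a b
  ae_hasDerivAt : ∀ᵐ x : ℝ, x ∈ Ioo a b → HasDerivAt f (f' x) x

lemma _root_.AbsolutelyContinuousOnInterval.comp_lipschitzOnWith {X Y : Type*}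
    [PseudoMetricSpace X] [PseudoMetricSpace Y] {f : ℝ → X} {g : X → Y} {a b : ℝ} {K : NNReal}
    {s : Set X} (hf : AbsolutelyContinuousOnInterval f a b) (hg : LipschitzOnWith K g s)
    (hs : MapsTo f (uIcc a b) s) : AbsolutelyContinuousOnInterval (fun x ↦ g (f x)) a b := by
  rw [absolutelyContinuousOnInterval_iff] at hf ⊢
  intro ε hε
  -- `K + 1` because `K` may be zero.
  obtain ⟨δ, hδ, h⟩ := hf (ε / (K + 1)) (by positivity)
  refine ⟨δ, hδ, fun E hE hlt ↦ ?_⟩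
  have h1 := h E hE hlt
  have h0 : 0 ≤ ∑ i ∈ Finset.range E.1, dist (f (E.2 i).1) (f (E.2 i).2) :=
    Finset.sum_nonneg fun _ _ ↦ dist_nonneg
  calc ∑ i ∈ Finset.range E.1, dist (g (f (E.2 i).1)) (g (f (E.2 i).2))
      ≤ ∑ i ∈ Finset.range E.1, K * dist (f (E.2 i).1) (f (E.2 i).2) :=
        Finset.sum_le_sum fun i hi ↦
          hg.dist_le_mul _ (hs (hE.1 i hi).1) _ (hs (hE.1 i hi).2)
    _ = K * ∑ i ∈ Finset.range E.1, dist (f (E.2 i).1) (f (E.2 i).2) := by rw [Finset.mul_sum]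
    _ ≤ (K + 1) * ∑ i ∈ Finset.range E.1, dist (f (E.2 i).1) (f (E.2 i).2) := by
        gcongr; linarith
    _ < (K + 1) * (ε / (K + 1)) := by gcongr
    _ = ε := by field_simp

lemma _root_.AbsolutelyContinuousOnInterval.congr {X : Type*} [PseudoMetricSpace X] {f g : ℝ → X}
    {a b : ℝ} (hf : AbsolutelyContinuousOnInterval f a b) (h : EqOn f g (uIcc a b)) :
    AbsolutelyContinuousOnInterval g a b := by
  rw [absolutelyContinuousOnInterval_iff] at hf ⊢
  intro ε hε
  obtain ⟨δ, hδ, H⟩ := hf ε hε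
  refine ⟨δ, hδ, fun E hE hlt ↦ ?_⟩
  convert H E hE hlt using 1
  refine Finset.sum_congr rfl fun i hi ↦ ?_
  rw [h (hE.1 i hi).1, h (hE.1 i hi).2]

namespace HasACDeriv

variable {f f' g g' : ℝ → ℝ} {a b c d : ℝ}

lemma continuousOn (h : HasACDeriv f f' a b) (hab : a ≤ b) : ContinuousOn f (Icc a b) := by
  simpa [uIcc_of_le hab] using h.ac.continuousOn

lemma congr_deriv (h : HasACDeriv f f' a b) (h' : ∀ᵐ x : ℝ, x ∈ Ioo a b → f' x = g' x) :
    HasACDeriv f g' a b := by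
  refine ⟨h.ac, ?_⟩
  filter_upwards [h.ae_hasDerivAt, h'] with x h1 h2 hx
  exact h2 hx ▸ h1 hx

lemma congr (h : HasACDeriv f f' a b) (hab : a ≤ b) (hfg : EqOn f g (Icc a b)) :
    HasACDeriv g f' a b := by
  refine ⟨h.ac.congr (by rwa [uIcc_of_le hab]), ?_⟩
  filter_upwards [h.ae_hasDerivAt] with x h1 hx
  refine (h1 hx).congr_of_eventuallyEq ?_
  filter_upwards [isOpen_Ioo.mem_nhds hx] with z hz using (hfg (Ioo_subset_Icc_self hz)).symm

lemma mono (h : HasACDeriv f f' a b) (hac : a ≤ c) (hcd : c ≤ d) (hdb : d ≤ b) :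
    HasACDeriv f f' c d := by
  refine ⟨h.ac.mono ?_, ?_⟩
  · rw [uIcc_of_le hcd, uIcc_of_le (hac.trans (hcd.trans hdb))]
    exact Icc_subset_Icc hac hdb
  · filter_upwards [h.ae_hasDerivAt] with x h1 hx
    exact h1 ⟨hac.trans_lt hx.1, hx.2.trans_le hdb⟩

lemma add (hf : HasACDeriv f f' a b) (hg : HasACDeriv g g' a b) :
    HasACDeriv (fun x ↦ f x + g x) (fun x ↦ f' x + g' x) a b := by
  refine ⟨hf.ac.add hg.ac, ?_⟩
  filter_upwards [hf.ae_hasDerivAt, hg.ae_hasDerivAt] with x h1 h2 hx using (h1 hx).add (h2 hx)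

lemma sub (hf : HasACDeriv f f' a b) (hg : HasACDeriv g g' a b) :
    HasACDeriv (fun x ↦ f x - g x) (fun x ↦ f' x - g' x) a b := by
  refine ⟨hf.ac.sub hg.ac, ?_⟩
  filter_upwards [hf.ae_hasDerivAt, hg.ae_hasDerivAt] with x h1 h2 hx using (h1 hx).sub (h2 hx)

lemma mul (hf : HasACDeriv f f' a b) (hg : HasACDeriv g g' a b) :
    HasACDeriv (fun x ↦ f x * g x) (fun x ↦ f' x * g x + f x * g' x) a b := by
  refine ⟨hf.ac.mul hg.ac, ?_⟩
  filter_upwards [hf.ae_hasDerivAt, hg.ae_hasDerivAt] with x h1 h2 hx using (h1 hx).mul (h2 hx)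

/-- A `C¹` function is Lipschitz on the bounded interval that contains the values of `f`. -/
lemma comp {φ φ' : ℝ → ℝ} (hφ : ∀ x, HasDerivAt φ (φ' x) x) (hφ' : Continuous φ')
    (hf : HasACDeriv f f' a b) : HasACDeriv (fun x ↦ φ (f x)) (fun x ↦ φ' (f x) * f' x) a b := by
  constructor
  · obtain ⟨C, hC⟩ := hf.ac.exists_bound
    have hcd : ContDiff ℝ 1 φ := by
      rw [contDiff_one_iff_deriv]
      refine ⟨fun x ↦ (hφ x).differentiableAt, ?_⟩
      rwa [show deriv φ = φ' from funext fun x ↦ (hφ x).deriv]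
    obtain ⟨K, hK⟩ := (hcd.contDiffOn (s := Icc (-C) C)).exists_lipschitzOnWith
      (by decide) (convex_Icc _ _) isCompact_Icc
    exact hf.ac.comp_lipschitzOnWith hK fun x hx ↦ abs_le.1 (hC x hx)
  · filter_upwards [hf.ae_hasDerivAt] with x h1 hx
    exact (hφ (f x)).comp x (h1 hx)

lemma const (C : ℝ) : HasACDeriv (fun _ ↦ C) (fun _ ↦ 0) a b := by
  refine ⟨?_, .of_forall fun x _ ↦ hasDerivAt_const _ _⟩
  exact (LipschitzWith.const C (α := ℝ)).lipschitzOnWith.absolutelyContinuousOnInterval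

lemma primitive (hab : a ≤ b) (hf : IntervalIntegrable f volume a b) :
    HasACDeriv (fun x ↦ ∫ t in a..x, f t) f a b := by
  refine ⟨hf.absolutelyContinuousOnInterval_intervalIntegral (by simp), ?_⟩
  filter_upwards [hf.ae_hasDerivAt_integral] with x h1 hx
  exact h1 (by rw [uIcc_of_le hab]; exact Ioo_subset_Icc_self hx) a (by simp)

lemma ae_deriv_eq (h : HasACDeriv f f' a b) (hab : a ≤ b) :
    ∀ᵐ x : ℝ, x ∈ uIoc a b → deriv f x = f' x := by
  have hne : ∀ᵐ x : ℝ, x ≠ b := by simp [ae_iff, measure_singleton]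
  filter_upwards [h.ae_hasDerivAt, hne] with x h1 h2 hx
  rw [uIoc_of_le hab] at hx
  exact (h1 ⟨hx.1, lt_of_le_of_ne hx.2 h2⟩).deriv

lemma intervalIntegrable (h : HasACDeriv f f' a b) (hab : a ≤ b) :
    IntervalIntegrable f' volume a b := by
  refine h.ac.intervalIntegrable_deriv.congr_ae ?_
  rw [Filter.EventuallyEq, ae_restrict_iff' measurableSet_uIoc]
  exact h.ae_deriv_eq hab

lemma integral_eq (h : HasACDeriv f f' a b) (hab : a ≤ b) : ∫ x in a..b, f' x = f b - f a := by
  rw [← h.ac.integral_deriv_eq_sub]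
  refine intervalIntegral.integral_congr_ae ?_
  filter_upwards [h.ae_deriv_eq hab] with x hx h' using (hx h').symm

lemma le_of_deriv_nonneg (h : HasACDeriv f f' a b) (hab : a ≤ b)
    (h0 : ∀ᵐ x : ℝ, x ∈ Ioo a b → 0 ≤ f' x) : f a ≤ f b := by
  have h1 : 0 ≤ ∫ x in a..b, f' x := by
    rw [intervalIntegral.integral_of_le hab, integral_Ioc_eq_integral_Ioo]
    refine integral_nonneg_of_ae ?_
    rw [Filter.EventuallyLE, ae_restrict_iff' measurableSet_Ioo]
    exact h0
  rw [h.integral_eq hab] at h1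
  linarith

lemma const_of_deriv_zero (h : HasACDeriv f f' a b)
    (h0 : ∀ᵐ x : ℝ, x ∈ Ioo a b → f' x = 0) {x : ℝ} (hx : x ∈ Icc a b) : f x = f a := by
  have h1 := (h.congr_deriv h0).mono le_rfl hx.1 hx.2
  have h2 := h1.integral_eq hx.1
  simp only [intervalIntegral.integral_zero] at h2
  linarith

lemma of_continuousOn (hab : a ≤ b) (hf : ∀ x ∈ Icc a b, HasDerivWithinAt f (f' x) (Icc a b) x)
    (hf' : ContinuousOn f' (Icc a b)) : HasACDeriv f f' a b := by
  constructor
  · obtain ⟨C, hC⟩ := isCompact_Icc.exists_bound_of_continuousOn hf'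
    have hC' : ∀ x ∈ Icc a b, ‖f' x‖₊ ≤ C.toNNReal := fun x hx ↦ by
      rw [← NNReal.coe_le_coe, coe_nnnorm]
      exact (hC x hx).trans (le_coe_toNNReal C)
    have := (convex_Icc a b).lipschitzOnWith_of_nnnorm_hasDerivWithin_le hf hC'
    rw [← uIcc_of_le hab] at this
    exact this.absolutelyContinuousOnInterval
  · refine .of_forall fun x hx ↦ ?_
    exact (hf x (Ioo_subset_Icc_self hx)).hasDerivAt (Icc_mem_nhds hx.1 hx.2)

/-- `f` is the integral of its a.e. derivative, so continuity of the latter upgrades it to a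
derivative at every point, one-sided at the ends. -/
lemma hasDerivWithinAt (h : HasACDeriv f f' a b) (hf' : ContinuousOn f' (Icc a b)) {x : ℝ}
    (hx : x ∈ Icc a b) : HasDerivWithinAt f (f' x) (Icc a b) x := by
  have hab : a ≤ b := hx.1.trans hx.2
  have hd : HasDerivWithinAt (fun z ↦ f a + ∫ t in a..z, f' t) (f' x) (Icc a b) x := by
    refine HasDerivWithinAt.const_add _ ?_
    have : Fact (x ∈ Icc a b) := ⟨hx⟩
    refine intervalIntegral.integral_hasDerivWithinAt_right
      ((h.mono le_rfl hx.1 hx.2).intervalIntegrable hx.1) (t := Icc a b)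
      (hf'.stronglyMeasurableAtFilter_nhdsWithin measurableSet_Icc x) (hf' x hx)
  refine hd.congr (fun z hz ↦ ?_) ?_
  · rw [(h.mono le_rfl hz.1 hz.2).integral_eq hz.1]; ring
  · rw [(h.mono le_rfl hx.1 hx.2).integral_eq hx.1]; ring

/-- Variation of constants for a scalar linear equation with summable coefficients. -/
lemma linear {w w' G g h : ℝ → ℝ} (hw : HasACDeriv w w' a b) (hG : HasACDeriv G g a b)
    (hw' : ∀ᵐ x : ℝ, x ∈ Ioo a b → w' x = g x * w x + h x) :
    HasACDeriv (fun x ↦ exp (-G x) * w x) (fun x ↦ exp (-G x) * h x) a b := by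
  have hE : HasACDeriv (fun x ↦ exp (-G x)) (fun x ↦ -exp (-G x) * g x) a b :=
    hG.comp (φ := fun x ↦ exp (-x)) (φ' := fun x ↦ -exp (-x))
      (fun x ↦ by simpa using (hasDerivAt_neg x).exp) (by fun_prop)
  refine (hE.mul hw).congr_deriv ?_
  filter_upwards [hw'] with x h1 hx
  rw [h1 hx]; ring

end HasACDeriv

/-! ### Carathéodory existence -/

/-- Global existence for a scalar Carathéodory equation with a summable Lipschitz constant. -/
theorem exists_hasACDeriv_of_lipschitz {F : ℝ → ℝ → ℝ} {k : ℝ → ℝ} {a b : ℝ} (hab : a ≤ b)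
    (hk : IntervalIntegrable k volume a b)
    (hF : ∀ v : ℝ → ℝ, ContinuousOn v (Icc a b) →
      IntervalIntegrable (fun t ↦ F t (v t)) volume a b)
    (hL : ∀ t x y, |F t x - F t y| ≤ k t * |x - y|) (c : ℝ) :
    ∃ θ : ℝ → ℝ, HasACDeriv θ (fun t ↦ F t (θ t)) a b ∧ θ a = c := by
  have hk0 : ∀ t, 0 ≤ k t := fun t ↦ by
    have := (abs_nonneg _).trans (hL t 1 0); simpa using this
  set K : ℝ → ℝ := fun x ↦ ∫ t in a..x, k t with hKdef
  have hK : HasACDeriv K k a b := .primitive hab hk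
  have hKc : ContinuousOn K (Icc a b) := hK.continuousOn hab
  have hKa : K a = 0 := by simp [hKdef]
  have hE : HasACDeriv (fun x ↦ exp (2 * K x) / 2) (fun x ↦ exp (2 * K x) * k x) a b :=
    hK.comp (φ := fun x ↦ exp (2 * x) / 2) (φ' := fun x ↦ exp (2 * x)) (fun x ↦ by
      have := (((hasDerivAt_id x).const_mul 2).exp).div_const 2
      refine this.congr_deriv ?_
      simp) (by fun_prop)
  -- Bielecki's weight: the unknown is `u = exp (-2 K) v`, and `V` recovers `v`. In the sup norm of
  -- `u` the Picard map contracts by `1 / 2` on the whole interval, because `exp (2 K) / 2` is a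
  -- primitive of `exp (2 K) k`.
  let V : C(Icc a b, ℝ) → ℝ → ℝ := fun u t ↦ exp (2 * K t) * IccExtend hab u t
  have hV : ∀ u, ContinuousOn (V u) (Icc a b) := fun u ↦
    (continuousOn_const.mul hKc).rexp.mul (u.continuous.Icc_extend' (h := hab)).continuousOn
  have hI : ∀ u, HasACDeriv (fun x ↦ ∫ t in a..x, F t (V u t)) (fun t ↦ F t (V u t)) a b :=
    fun u ↦ .primitive hab (hF _ (hV u))
  have hNc : ∀ u, ContinuousOn (fun x ↦ exp (-(2 * K x)) * (c + ∫ t in a..x, F t (V u t)))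
      (Icc a b) := fun u ↦
    (continuousOn_const.mul hKc).neg.rexp.mul (continuousOn_const.add ((hI u).continuousOn hab))
  let N : C(Icc a b, ℝ) → C(Icc a b, ℝ) := fun u ↦
    ⟨_, continuousOn_iff_continuous_domRestrict.1 (hNc u)⟩
  have hNapp : ∀ u (x : Icc a b),
      N u x = exp (-(2 * K x)) * (c + ∫ t in a..(x : ℝ), F t (V u t)) := fun u x ↦ rfl
  have hcontr : ContractingWith (1 / 2) N := by
    refine ⟨by norm_num, LipschitzWith.of_dist_le_mul fun u v ↦ ?_⟩
    rw [ContinuousMap.dist_le (by positivity)]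
    intro x
    have hx := x.2
    have hi1 := ((hI u).mono le_rfl hx.1 hx.2).intervalIntegrable hx.1
    have hi2 := ((hI v).mono le_rfl hx.1 hx.2).intervalIntegrable hx.1
    have hE' := hE.mono le_rfl hx.1 hx.2
    rw [hNapp, hNapp, Real.dist_eq, ← mul_sub, abs_mul, abs_of_pos (exp_pos _),
      add_sub_add_left_eq_sub, ← intervalIntegral.integral_sub hi1 hi2]
    have h1 : |∫ t in a..(x : ℝ), (F t (V u t) - F t (V v t))| ≤
        ∫ t in a..(x : ℝ), dist u v * (exp (2 * K t) * k t) := by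
      rw [← Real.norm_eq_abs]
      refine intervalIntegral.norm_integral_le_of_norm_le hx.1 (.of_forall fun t ht ↦ ?_)
        ((hE'.intervalIntegrable hx.1).const_mul _)
      rw [Real.norm_eq_abs]
      refine (hL _ _ _).trans ?_
      simp only [V]
      rw [← mul_sub, abs_mul, abs_of_pos (exp_pos _)]
      have : |IccExtend hab u t - IccExtend hab v t| ≤ dist u v := by
        simpa [IccExtend, Real.dist_eq] using
          ContinuousMap.dist_apply_le_dist (f := u) (g := v) (projIcc a b hab t)
      have h3 := mul_le_mul_of_nonneg_left this (mul_nonneg (hk0 t) (exp_pos (2 * K t)).le)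
      linarith
    rw [intervalIntegral.integral_const_mul, hE'.integral_eq hx.1, hKa] at h1
    have h2 : exp (-(2 * K x)) * exp (2 * K x) = 1 := by rw [← exp_add]; simp
    have hd : 0 ≤ dist u v := dist_nonneg
    have he := exp_pos (-(2 * K x))
    calc exp (-(2 * K x)) * |∫ t in a..(x : ℝ), (F t (V u t) - F t (V v t))|
        ≤ exp (-(2 * K x)) * (dist u v * (exp (2 * K x) / 2 - exp (2 * 0) / 2)) := by gcongr
      _ = (1 / 2) * dist u v * (exp (-(2 * K x)) * exp (2 * K x))
          - exp (-(2 * K x)) * dist u v / 2 := by simp; ring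
      _ ≤ (1 / 2) * dist u v := by
          rw [h2]; have := mul_nonneg he.le hd; linarith
      _ = ((1 / 2 : NNReal) : ℝ) * dist u v := by simp
  have : Nonempty (Icc a b) := ⟨⟨a, le_rfl, hab⟩⟩
  let u := ContractingWith.fixedPoint N hcontr
  have hu : N u = u := hcontr.fixedPoint_isFixedPt
  have hfix : EqOn (fun x ↦ c + ∫ t in a..x, F t (V u t)) (V u) (Icc a b) := fun x hx ↦ by
    have h1 := hNapp u ⟨x, hx⟩
    rw [hu] at h1
    have h2 : exp (2 * K x) * exp (-(2 * K x)) = 1 := by rw [← exp_add]; simp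
    simp only [V]
    rw [IccExtend_of_mem hab _ hx, h1, ← mul_assoc, h2, one_mul]
  refine ⟨V u, ?_, ?_⟩
  · have := ((HasACDeriv.const (a := a) (b := b) c).add (hI u)).congr hab hfix
    simpa using this
  · rw [← hfix ⟨le_rfl, hab⟩]; simp

/-! ### The Prüfer angle and its comparison principles -/

/-- The Prüfer angle equation of `-y'' + q y = μ y` on `[0, π]`. -/
def IsAngle (q : ℝ → ℝ) (μ : ℝ) (θ : ℝ → ℝ) : Prop :=
  HasACDeriv θ (fun x ↦ cos (θ x) ^ 2 + (μ - q x) * sin (θ x) ^ 2) 0 π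

lemma intervalIntegrable_of_integrableOn {q : ℝ → ℝ} (hq : IntegrableOn q (Icc 0 π)) :
    IntervalIntegrable q volume 0 π :=
  (intervalIntegrable_iff_integrableOn_Icc_of_le pi_pos.le).2 hq

/-- The difference quotient of the right-hand side of the angle equation. -/
def angleSlope (q : ℝ → ℝ) (μ : ℝ) (θ σ : ℝ → ℝ) (x : ℝ) : ℝ :=
  (μ - 1 - q x) * (sinc (σ x - θ x) * sin (σ x + θ x))

/-- From `sin² s - sin² t = sin (s - t) sin (s + t)`; `sinc` keeps the quotient by `s - t`
continuous across `s = t`. -/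
lemma angle_rhs_sub (m s t : ℝ) :
    (cos s ^ 2 + m * sin s ^ 2) - (cos t ^ 2 + m * sin t ^ 2) =
      (m - 1) * (sinc (s - t) * sin (s + t)) * (s - t) := by
  have h1 : sinc (s - t) * (s - t) = sin (s - t) := by
    by_cases h : s - t = 0
    · simp [h]
    · rw [sinc_of_ne_zero h]; field_simp
  have h2 : sin (s - t) * sin (s + t) = sin s ^ 2 - sin t ^ 2 := by
    rw [sin_sub, sin_add]
    nlinarith [sin_sq_add_cos_sq s, sin_sq_add_cos_sq t]
  calc _ = (m - 1) * (sin s ^ 2 - sin t ^ 2) := by rw [cos_sq', cos_sq']; ring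
    _ = (m - 1) * (sinc (s - t) * (s - t) * sin (s + t)) := by rw [h1, h2]
    _ = _ := by ring

lemma abs_sinc_mul_sin_le (s t : ℝ) : |sinc s * sin t| ≤ 1 := by
  rw [abs_mul]
  exact mul_le_one₀ (abs_sinc_le_one s) (abs_nonneg _) (abs_sin_le_one t)

variable {q : ℝ → ℝ} {μ ν : ℝ} {θ σ : ℝ → ℝ}

lemma angleSlope_intervalIntegrable (hq : IntegrableOn q (Icc 0 π)) (μ : ℝ)
    (hθ : ContinuousOn θ (Icc 0 π)) (hσ : ContinuousOn σ (Icc 0 π)) :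
    IntervalIntegrable (angleSlope q μ θ σ) volume 0 π := by
  refine (intervalIntegrable_const.sub (intervalIntegrable_of_integrableOn hq)).mul_continuousOn ?_
  rw [uIcc_of_le pi_pos.le]
  exact (continuous_sinc.comp_continuousOn (hσ.sub hθ)).mul
    (continuous_sin.comp_continuousOn (hσ.add hθ))

theorem exists_isAngle (hq : IntegrableOn q (Icc 0 π)) (μ c : ℝ) :
    ∃ θ, IsAngle q μ θ ∧ θ 0 = c := by
  have hqi := intervalIntegrable_of_integrableOn hq
  refine exists_hasACDeriv_of_lipschitz (k := fun t ↦ |μ - 1 - q t|)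
    (F := fun x y ↦ cos y ^ 2 + (μ - q x) * sin y ^ 2) pi_pos.le
    (intervalIntegrable_const.sub hqi).abs (fun v hv ↦ ?_) (fun t x y ↦ ?_) c
  · rw [← uIcc_of_le pi_pos.le] at hv
    exact ((continuous_cos.comp_continuousOn hv).pow 2).intervalIntegrable.add
      ((intervalIntegrable_const.sub hqi).mul_continuousOn ((continuous_sin.comp_continuousOn hv).pow 2))
  · rw [angle_rhs_sub, abs_mul, abs_mul, show μ - q t - 1 = μ - 1 - q t by ring]
    gcongr
    exact mul_le_of_le_one_right (abs_nonneg _) (abs_sinc_mul_sin_le _ _)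

/-- The variation of constants formula for the difference of a Prüfer angle and another function,
with defect `h`. -/
lemma IsAngle.sub_linear {σ' h : ℝ → ℝ} {a b : ℝ} (hq : IntegrableOn q (Icc 0 π))
    (hθ : IsAngle q μ θ) (hσ : ContinuousOn σ (Icc 0 π)) (ha : 0 ≤ a) (hab : a ≤ b) (hb : b ≤ π)
    (hσ' : HasACDeriv σ σ' a b)
    (hh : ∀ᵐ x : ℝ, x ∈ Ioo a b →
      σ' x = cos (σ x) ^ 2 + (μ - q x) * sin (σ x) ^ 2 + h x) :
    HasACDeriv (fun x ↦ exp (-∫ t in (0 : ℝ)..x, angleSlope q μ θ σ t) * (σ x - θ x))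
      (fun x ↦ exp (-∫ t in (0 : ℝ)..x, angleSlope q μ θ σ t) * h x) a b := by
  have hG := HasACDeriv.primitive pi_pos.le
    (angleSlope_intervalIntegrable hq μ (hθ.continuousOn pi_pos.le) hσ)
  refine HasACDeriv.linear (hσ'.sub (hθ.mono ha hab hb)) (hG.mono ha hab hb) ?_
  filter_upwards [hh] with x h1 hx
  have := angle_rhs_sub (μ - q x) (σ x) (θ x)
  rw [h1 hx, angleSlope]
  rw [show μ - 1 - q x = μ - q x - 1 by ring]
  linarith

/-- A supersolution of the angle equation dominates the angle. -/
lemma IsAngle.le_of_supersolution {σ' : ℝ → ℝ} (hq : IntegrableOn q (Icc 0 π))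
    (hθ : IsAngle q μ θ) (hσ : HasACDeriv σ σ' 0 π)
    (h : ∀ᵐ x : ℝ, x ∈ Ioo 0 π → cos (σ x) ^ 2 + (μ - q x) * sin (σ x) ^ 2 ≤ σ' x)
    (h0 : θ 0 ≤ σ 0) : θ π ≤ σ π := by
  have h1 := hθ.sub_linear hq (hσ.continuousOn pi_pos.le) le_rfl pi_pos.le le_rfl hσ
    (h := fun x ↦ σ' x - (cos (σ x) ^ 2 + (μ - q x) * sin (σ x) ^ 2)) (.of_forall fun x _ ↦ by ring)
  have h2 := h1.le_of_deriv_nonneg pi_pos.le (by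
    filter_upwards [h] with x hx hx'
    exact mul_nonneg (exp_pos _).le (sub_nonneg.2 (hx hx')))
  have h3 : 0 ≤ exp (-∫ t in (0 : ℝ)..π, angleSlope q μ θ σ t) * (σ π - θ π) :=
    le_trans (mul_nonneg (exp_pos _).le (sub_nonneg.2 h0)) h2
  have := nonneg_of_mul_nonneg_right h3 (exp_pos _)
  linarith

/-- Once the angle has reached a multiple of `π`, it stays strictly above it. -/
lemma IsAngle.lt_of_le (hq : IntegrableOn q (Icc 0 π)) (hθ : IsAngle q μ θ) (m : ℤ) {a b : ℝ}
    (ha : 0 ≤ a) (hab : a < b) (hb : b ≤ π) (h : m * π ≤ θ a) : m * π < θ b := by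
  -- At a multiple of `π` the right-hand side of the angle equation is `cos² = 1`, whatever `q` is,
  -- so the constant `m π` has defect `-1`: it is a strict subsolution.
  have h1 := hθ.sub_linear hq (σ := fun _ ↦ m * π) continuousOn_const ha hab.le hb
    (HasACDeriv.const _) (h := fun _ ↦ -1) (.of_forall fun x _ ↦ by
      have : cos (m * π) ^ 2 = 1 := by rw [cos_sq', sin_int_mul_pi]; simp
      simp [this])
  set E : ℝ → ℝ := fun x ↦ exp (-∫ t in (0 : ℝ)..x, angleSlope q μ θ (fun _ ↦ m * π) t) with hE
  have hEc : ContinuousOn E (Icc a b) := by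
    have hG := HasACDeriv.primitive pi_pos.le
      (angleSlope_intervalIntegrable hq μ (hθ.continuousOn pi_pos.le)
        (σ := fun _ ↦ m * π) continuousOn_const)
    exact ((hG.continuousOn pi_pos.le).mono (Icc_subset_Icc ha hb)).neg.rexp
  have h2 := h1.integral_eq hab.le
  have h3 : 0 < ∫ x in a..b, E x :=
    intervalIntegral.intervalIntegral_pos_of_pos_on
      (hEc.intervalIntegrable_of_Icc hab.le) (fun x _ ↦ exp_pos _) hab
  have h4 : ∫ x in a..b, E x * -1 = -∫ x in a..b, E x := by simp
  rw [h4] at h2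
  have h5 : E a * (m * π - θ a) ≤ 0 :=
    mul_nonpos_of_nonneg_of_nonpos (exp_pos _).le (by linarith)
  have h6 : E b * (m * π - θ b) < 0 := by linarith
  have h7 : 0 < E b := exp_pos _
  by_contra hcon
  have : 0 ≤ E b * (m * π - θ b) := mul_nonneg h7.le (by linarith)
  linarith

/-- If `sin θ` vanished throughout, `θ` would have slope 1, and `θ (π / 2) = θ 0 + π / 2` would make
`cos (θ 0)` vanish together with `sin (θ 0)`. -/
lemma IsAngle.not_sin_eq_zero (hθ : IsAngle q μ θ) : ∃ x ∈ Icc 0 π, sin (θ x) ≠ 0 := by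
  by_contra! hcon
  have h1 : HasACDeriv θ (fun _ ↦ 1) 0 π := hθ.congr_deriv (.of_forall fun x hx ↦ by
    rw [cos_sq', hcon x (Ioo_subset_Icc_self hx)]; simp)
  have hp := pi_pos
  have h2 := (h1.mono le_rfl (by positivity) (by linarith : π / 2 ≤ π)).integral_eq (by positivity)
  have h3 : θ (π / 2) = θ 0 + π / 2 := by simp at h2; linarith
  have h4 := hcon (π / 2) ⟨by positivity, by linarith⟩
  have h5 := hcon 0 ⟨le_rfl, hp.le⟩
  rw [h3, sin_add_pi_div_two] at h4
  have := sin_sq_add_cos_sq (θ 0)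
  rw [h4, h5] at this
  norm_num at this

/-- An angle for `ν` has defect `(ν - μ) sin²` in the equation for `μ`. This formula yields both
strict monotonicity and continuity in the parameter. -/
lemma IsAngle.exp_mul_sub (hq : IntegrableOn q (Icc 0 π)) (hθ : IsAngle q μ θ)
    (hσ : IsAngle q ν σ) (h0 : θ 0 = σ 0) :
    exp (-∫ t in (0 : ℝ)..π, angleSlope q μ θ σ t) * (σ π - θ π) =
      (ν - μ) * ∫ x in (0 : ℝ)..π,
        exp (-∫ t in (0 : ℝ)..x, angleSlope q μ θ σ t) * sin (σ x) ^ 2 := by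
  have h1 := hθ.sub_linear hq (hσ.continuousOn pi_pos.le) le_rfl pi_pos.le le_rfl hσ
    (h := fun x ↦ (ν - μ) * sin (σ x) ^ 2) (.of_forall fun x _ ↦ by ring)
  have h2 := h1.integral_eq pi_pos.le
  rw [h0, sub_self, mul_zero, sub_zero] at h2
  rw [← h2, ← intervalIntegral.integral_const_mul]
  congr 1; ext x; ring

lemma continuousOn_exp_neg_integral_angleSlope (hq : IntegrableOn q (Icc 0 π))
    (hθ : ContinuousOn θ (Icc 0 π)) (hσ : ContinuousOn σ (Icc 0 π)) :
    ContinuousOn (fun x ↦ exp (-∫ t in (0 : ℝ)..x, angleSlope q μ θ σ t)) (Icc 0 π) :=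
  ((HasACDeriv.primitive pi_pos.le
    (angleSlope_intervalIntegrable hq μ hθ hσ)).continuousOn pi_pos.le).neg.rexp

/-- The terminal angle is strictly increasing in the spectral parameter. -/
theorem IsAngle.lt_of_lt (hq : IntegrableOn q (Icc 0 π)) (hθ : IsAngle q μ θ)
    (hσ : IsAngle q ν σ) (h0 : θ 0 = σ 0) (hμν : μ < ν) : θ π < σ π := by
  have h1 := hθ.exp_mul_sub hq hσ h0
  have hσc := hσ.continuousOn pi_pos.le
  obtain ⟨z, hz, hz'⟩ := hσ.not_sin_eq_zero
  have h2 : 0 < ∫ x in (0 : ℝ)..π,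
      exp (-∫ t in (0 : ℝ)..x, angleSlope q μ θ σ t) * sin (σ x) ^ 2 := by
    refine intervalIntegral.integral_pos pi_pos
      ((continuousOn_exp_neg_integral_angleSlope hq (hθ.continuousOn pi_pos.le) hσc).mul
        ((continuous_sin.comp_continuousOn hσc).pow 2)) (fun x _ ↦ by positivity) ⟨z, hz, by positivity⟩
  have h3 := mul_pos (sub_pos.2 hμν) h2
  rw [← h1] at h3
  linarith [pos_of_mul_pos_right h3 (exp_pos _).le]

/-- The terminal angle is locally Lipschitz in the spectral parameter. -/
theorem IsAngle.abs_sub_le (hq : IntegrableOn q (Icc 0 π)) (hθ : IsAngle q μ θ)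
    (hσ : IsAngle q ν σ) (h0 : θ 0 = σ 0) :
    |σ π - θ π| ≤ |ν - μ| * (π * exp (2 * ∫ t in (0 : ℝ)..π, |μ - 1 - q t|)) := by
  have h1 := hθ.exp_mul_sub hq hσ h0
  have hσc := hσ.continuousOn pi_pos.le
  have hθc := hθ.continuousOn pi_pos.le
  -- The bound collects `exp A` twice: once from the weight under the integral, once from dividing
  -- by the weight at `π`.
  set A := ∫ t in (0 : ℝ)..π, |μ - 1 - q t| with hA
  have hki : IntervalIntegrable (fun t ↦ |μ - 1 - q t|) volume 0 π :=
    (intervalIntegrable_const.sub (intervalIntegrable_of_integrableOn hq)).abs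
  have hb : ∀ x ∈ Icc 0 π, |∫ t in (0 : ℝ)..x, angleSlope q μ θ σ t| ≤ A := fun x hx ↦ by
    have hx' : IntervalIntegrable (fun t ↦ |μ - 1 - q t|) volume 0 x :=
      hki.mono_set (by rw [uIcc_of_le hx.1, uIcc_of_le pi_pos.le]; exact Icc_subset_Icc_right hx.2)
    calc _ ≤ ∫ t in (0 : ℝ)..x, |μ - 1 - q t| := by
          rw [← Real.norm_eq_abs]
          refine intervalIntegral.norm_integral_le_of_norm_le hx.1 (.of_forall fun t _ ↦ ?_) hx'
          rw [Real.norm_eq_abs, angleSlope, abs_mul]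
          exact mul_le_of_le_one_right (abs_nonneg _) (abs_sinc_mul_sin_le _ _)
      _ ≤ A := intervalIntegral.integral_mono_interval le_rfl hx.1 hx.2
          (.of_forall fun t ↦ abs_nonneg _) hki
  have h2 : |∫ x in (0 : ℝ)..π,
      exp (-∫ t in (0 : ℝ)..x, angleSlope q μ θ σ t) * sin (σ x) ^ 2| ≤ exp A * |π - 0| := by
    rw [← Real.norm_eq_abs]
    refine intervalIntegral.norm_integral_le_of_norm_le_const fun x hx ↦ ?_
    rw [uIoc_of_le pi_pos.le] at hx
    rw [Real.norm_eq_abs, abs_mul, abs_of_pos (exp_pos _), abs_of_nonneg (sq_nonneg _)]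
    refine (mul_le_of_le_one_right (exp_pos _).le (sin_sq_le_one _)).trans ?_
    rw [exp_le_exp]
    linarith [(abs_le.1 (hb x ⟨hx.1.le, hx.2⟩)).1]
  have h3 : |σ π - θ π| = exp (∫ t in (0 : ℝ)..π, angleSlope q μ θ σ t) *
      (|ν - μ| * |∫ x in (0 : ℝ)..π,
        exp (-∫ t in (0 : ℝ)..x, angleSlope q μ θ σ t) * sin (σ x) ^ 2|) := by
    rw [← abs_mul, ← h1, abs_mul, abs_of_pos (exp_pos _), ← mul_assoc, ← exp_add]
    simp
  have h4 : exp (∫ t in (0 : ℝ)..π, angleSlope q μ θ σ t) ≤ exp A :=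
    exp_le_exp.2 (abs_le.1 (hb π ⟨pi_pos.le, le_rfl⟩)).2
  rw [h3]
  calc _ ≤ exp A * (|ν - μ| * (exp A * |π - 0|)) := by gcongr
    _ = _ := by rw [sub_zero, abs_of_pos pi_pos, two_mul, exp_add]; ring

/-! ### The terminal angle for large positive and negative parameters -/

/-- The angle `φ` near `t` with `tan φ = k * tan t`. -/
def scaledAngle (k t : ℝ) : ℝ :=
  t + arctan ((k - 1) * (sin t * cos t) / (cos t ^ 2 + k * sin t ^ 2))

lemma cos_sq_add_mul_sin_sq_pos {k : ℝ} (hk : 0 < k) (t : ℝ) : 0 < cos t ^ 2 + k * sin t ^ 2 := by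
  by_cases h : sin t = 0
  · have := sin_sq_add_cos_sq t
    rw [h] at this ⊢
    linarith
  · positivity

lemma hasDerivAt_scaledAngle {k : ℝ} (hk : 0 < k) (t : ℝ) :
    HasDerivAt (scaledAngle k) (k / (cos t ^ 2 + k ^ 2 * sin t ^ 2)) t := by
  have hD := cos_sq_add_mul_sin_sq_pos hk t
  have hD2 := cos_sq_add_mul_sin_sq_pos (pow_pos hk 2) t
  have hs := hasDerivAt_sin t
  have hc := hasDerivAt_cos t
  have h1 := (((hs.mul hc).const_mul (k - 1)).div ((hc.pow 2).add ((hs.pow 2).const_mul k))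
    hD.ne').arctan
  refine ((hasDerivAt_id t).add h1).congr_deriv ?_
  have h2 : (cos t ^ 2 + k * sin t ^ 2) ^ 2 + ((k - 1) * (sin t * cos t)) ^ 2 =
      cos t ^ 2 + k ^ 2 * sin t ^ 2 := by
    linear_combination (cos t ^ 2 + k ^ 2 * sin t ^ 2) * sin_sq_add_cos_sq t
  simp only [Pi.mul_apply, Pi.pow_apply, Pi.add_apply, Pi.div_apply]
  have h3 : 1 + ((k - 1) * (sin t * cos t) / (cos t ^ 2 + k * sin t ^ 2)) ^ 2 =
      (cos t ^ 2 + k ^ 2 * sin t ^ 2) / (cos t ^ 2 + k * sin t ^ 2) ^ 2 := by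
    rw [← h2]; field_simp
  rw [h3]
  field_simp
  push_cast
  simp only [pow_one]
  linear_combination ((k - 1) * (cos t ^ 2 - k * sin t ^ 2) + k) * sin_sq_add_cos_sq t

lemma abs_scaledAngle_sub_lt (k t : ℝ) : |scaledAngle k t - t| < π / 2 := by
  rw [scaledAngle, add_sub_cancel_left, abs_lt]
  exact ⟨neg_pi_div_two_lt_arctan _, arctan_lt_pi_div_two _⟩

/-- In the scaled angle the equation becomes `φ' = k - q k sin² / (cos² + k² sin²)`, where the
factor of `q` is at most `1 / k`. Scaling moves the angle by less than `π / 2` at each end, which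
accounts for the final `π`. -/
lemma IsAngle.le_sub (hq : IntegrableOn q (Icc 0 π)) {k : ℝ} (hk : 0 < k)
    (hθ : IsAngle q (k ^ 2) θ) :
    k * π - (∫ x in (0 : ℝ)..π, |q x|) / k - π ≤ θ π - θ 0 := by
  have hqi := (intervalIntegrable_of_integrableOn hq).abs
  have h1 := hθ.comp (hasDerivAt_scaledAngle hk)
    (Continuous.div continuous_const (by fun_prop)
      fun t ↦ (cos_sq_add_mul_sin_sq_pos (pow_pos hk 2) t).ne')
  have h2 := HasACDeriv.primitive pi_pos.le
    ((intervalIntegrable_const (c := k)).sub (hqi.div_const k))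
  have h3 := (h1.sub h2).le_of_deriv_nonneg pi_pos.le (.of_forall fun x _ ↦ by
    set s := sin (θ x)
    set c := cos (θ x)
    have hD : 0 < c ^ 2 + k ^ 2 * s ^ 2 := cos_sq_add_mul_sin_sq_pos (pow_pos hk 2) (θ x)
    have h4 : k / (c ^ 2 + k ^ 2 * s ^ 2) * (c ^ 2 + (k ^ 2 - q x) * s ^ 2) =
        k - q x * (k * s ^ 2 / (c ^ 2 + k ^ 2 * s ^ 2)) := by
      field_simp; ring
    have h5 : k * s ^ 2 / (c ^ 2 + k ^ 2 * s ^ 2) ≤ 1 / k := by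
      rw [div_le_div_iff₀ hD hk]; nlinarith [sq_nonneg c]
    have h6 : 0 ≤ k * s ^ 2 / (c ^ 2 + k ^ 2 * s ^ 2) := by positivity
    have h7 : q x * (k * s ^ 2 / (c ^ 2 + k ^ 2 * s ^ 2)) ≤ |q x| / k := by
      calc _ ≤ |q x| * (k * s ^ 2 / (c ^ 2 + k ^ 2 * s ^ 2)) := by gcongr; exact le_abs_self _
        _ ≤ |q x| * (1 / k) := by gcongr
        _ = _ := by ring
    rw [h4]; linarith)
  rw [intervalIntegral.integral_same, intervalIntegral.integral_sub intervalIntegrable_const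
    (hqi.div_const k), intervalIntegral.integral_div, intervalIntegral.integral_const] at h3
  simp only [sub_zero, smul_eq_mul] at h3
  have h4 := abs_lt.1 (abs_scaledAngle_sub_lt k (θ π))
  have h5 := abs_lt.1 (abs_scaledAngle_sub_lt k (θ 0))
  linarith [h4.1, h4.2, h5.1, h5.2, mul_comm k π]

theorem exists_le_angle (hq : IntegrableOn q (Icc 0 π)) (M : ℝ) :
    ∃ μ, ∀ θ, IsAngle q μ θ → M ≤ θ π - θ 0 := by
  set A := ∫ x in (0 : ℝ)..π, |q x|
  have hA : 0 ≤ A := intervalIntegral.integral_nonneg pi_pos.le fun x _ ↦ abs_nonneg _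
  have hp := pi_gt_three
  refine ⟨(1 + |M| + A + π) ^ 2, fun θ hθ ↦ ?_⟩
  have hk : 1 ≤ 1 + |M| + A + π := by have := abs_nonneg M; linarith
  refine le_trans ?_ (hθ.le_sub hq (by linarith))
  have h1 : A / (1 + |M| + A + π) ≤ A := div_le_self hA hk
  have h2 := le_abs_self M
  nlinarith [abs_nonneg M]

/-- With `σ = arccot v`, being a supersolution means `v' ≤ q - μ - v²`. Taking `v' = A + q` cancels
`q`, and a bounded `v` leaves room for a sufficiently negative `μ`. -/
theorem exists_angle_lt (hq : IntegrableOn q (Icc 0 π)) {c ε : ℝ} (hc : c < π) (hε : 0 < ε) :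
    ∃ μ, ∀ θ, IsAngle q μ θ → θ 0 ≤ c → θ π < ε := by
  have hqi := intervalIntegrable_of_integrableOn hq
  have htan := tendsto_arctan_atTop.mono_right nhdsWithin_le_nhds
  -- `v` runs from `-B` to `C`: `B` places `σ 0` above `c`, which is possible because `c < π`, and
  -- `C` places `σ π` below `ε`. The constant `A` is then forced by the endpoint values.
  obtain ⟨B, hB⟩ := (htan.eventually (lt_mem_nhds (show c - π / 2 < π / 2 by linarith))).exists
  obtain ⟨C, hC⟩ := (htan.eventually (lt_mem_nhds (show π / 2 - ε < π / 2 by linarith))).exists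
  set I := ∫ x in (0 : ℝ)..π, q x
  set A := (C + B - I) / π with hA
  set v : ℝ → ℝ := fun x ↦ -B + ∫ t in (0 : ℝ)..x, (A + q t) with hv
  have hvd : HasACDeriv v (fun x ↦ A + q x) 0 π := by
    simpa using (HasACDeriv.const (-B)).add
      (HasACDeriv.primitive pi_pos.le (intervalIntegrable_const.add hqi))
  have hv0 : v 0 = -B := by simp [hv]
  have hvπ : v π = C := by
    simp only [hv]
    rw [intervalIntegral.integral_add intervalIntegrable_const hqi,
      intervalIntegral.integral_const, hA]
    have := pi_pos.ne'
    simp only [sub_zero, smul_eq_mul]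
    field_simp
    ring
  obtain ⟨S, hS⟩ := isCompact_Icc.exists_bound_of_continuousOn (hvd.continuousOn pi_pos.le)
  refine ⟨-(A + S ^ 2), fun θ hθ h0 ↦ ?_⟩
  have hσ := hvd.comp (φ := fun x ↦ π / 2 - arctan x) (φ' := fun x ↦ -(1 / (1 + x ^ 2)))
    (fun x ↦ (hasDerivAt_arctan x).const_sub _)
    (Continuous.neg (Continuous.div continuous_const (by fun_prop) fun x ↦ by positivity))
  have h1 := hθ.le_of_supersolution hq hσ (.of_forall fun x hx ↦ by
    have hD : 0 < 1 + v x ^ 2 := by positivity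
    rw [cos_pi_div_two_sub, sin_pi_div_two_sub, sin_sq, cos_sq_arctan]
    have h2 : v x ^ 2 ≤ S ^ 2 := by
      rw [← sq_abs]
      have := hS x (Ioo_subset_Icc_self hx)
      rw [norm_eq_abs] at this
      gcongr
    have h3 : -(1 / (1 + v x ^ 2)) * (A + q x) -
        (1 - 1 / (1 + v x ^ 2) + (-(A + S ^ 2) - q x) * (1 / (1 + v x ^ 2))) =
        (S ^ 2 - v x ^ 2) / (1 + v x ^ 2) := by
      field_simp; ring
    have h4 : 0 ≤ (S ^ 2 - v x ^ 2) / (1 + v x ^ 2) := div_nonneg (by linarith) hD.le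
    linarith) (by rw [hv0, arctan_neg]; linarith)
  rw [hvπ] at h1
  linarith

/-! ### The terminal angle as a function of the parameter -/

/-- A family of Prüfer angles with a common initial value, together with the behaviour of its
terminal values as a function of the spectral parameter. -/
structure IsAngleFamily (q : ℝ → ℝ) (c : ℝ) (Θ : ℝ → ℝ → ℝ) : Prop where
  isAngle : ∀ μ, IsAngle q μ (Θ μ)
  initial : ∀ μ, Θ μ 0 = c

theorem exists_isAngleFamily (hq : IntegrableOn q (Icc 0 π)) (c : ℝ) :
    ∃ Θ, IsAngleFamily q c Θ := by
  choose Θ h1 h2 using fun μ ↦ exists_isAngle hq μ c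
  exact ⟨Θ, h1, h2⟩

namespace IsAngleFamily

variable {c : ℝ} {Θ : ℝ → ℝ → ℝ}

lemma strictMono (hq : IntegrableOn q (Icc 0 π)) (h : IsAngleFamily q c Θ) :
    StrictMono fun μ ↦ Θ μ π := fun μ ν hμν ↦
  (h.isAngle μ).lt_of_lt hq (h.isAngle ν) (by rw [h.initial, h.initial]) hμν

lemma continuous (hq : IntegrableOn q (Icc 0 π)) (h : IsAngleFamily q c Θ) :
    Continuous fun μ ↦ Θ μ π := by
  rw [continuous_iff_continuousAt]
  intro μ
  rw [ContinuousAt, tendsto_iff_norm_sub_tendsto_zero]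
  refine squeeze_zero (fun _ ↦ norm_nonneg _) (fun ν ↦ (h.isAngle μ).abs_sub_le hq (h.isAngle ν)
    (by rw [h.initial, h.initial])) ?_
  have : Continuous fun ν ↦ |ν - μ| * (π * exp (2 * ∫ t in (0 : ℝ)..π, |μ - 1 - q t|)) := by
    fun_prop
  simpa using this.tendsto μ

lemma pos (hq : IntegrableOn q (Icc 0 π)) (h : IsAngleFamily q c Θ) (hc : 0 ≤ c) (μ : ℝ) :
    0 < Θ μ π := by
  simpa using (h.isAngle μ).lt_of_le hq 0 le_rfl pi_pos le_rfl (by simpa [h.initial μ] using hc)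

lemma exists_eq (hq : IntegrableOn q (Icc 0 π)) (h : IsAngleFamily q c Θ) (hc : c < π) {τ : ℝ}
    (hτ : 0 < τ) : ∃ μ, Θ μ π = τ := by
  obtain ⟨μ, hμ⟩ := exists_angle_lt hq hc hτ
  obtain ⟨ν, hν⟩ := exists_le_angle hq (τ - c)
  have h1 := hμ _ (h.isAngle μ) (h.initial μ).le
  have h2 := hν _ (h.isAngle ν)
  rw [h.initial] at h2
  exact mem_range_of_exists_le_of_exists_ge (h.continuous hq) ⟨μ, h1.le⟩ ⟨ν, by linarith⟩

end IsAngleFamily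

/-! ### Real solutions in polar form -/

/-- `(u, u')` solves the first-order system of `-y'' + q y = μ y` on `[0, π]`. -/
structure IsRealSolution (q : ℝ → ℝ) (μ : ℝ) (u u' : ℝ → ℝ) : Prop where
  left : HasACDeriv u u' 0 π
  right : HasACDeriv u' (fun x ↦ (q x - μ) * u x) 0 π

lemma IsRealSolution.wronskian_eq {u u' v v' : ℝ → ℝ} (hu : IsRealSolution q μ u u')
    (hv : IsRealSolution q μ v v') {x : ℝ} (hx : x ∈ Icc 0 π) :
    u x * v' x - u' x * v x = u 0 * v' 0 - u' 0 * v 0 :=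
  ((hu.left.mul hv.right).sub (hu.right.mul hv.left)).const_of_deriv_zero
    (.of_forall fun x _ ↦ by ring) hx

/-- The solution with a given Prüfer angle. -/
theorem IsAngle.exists_isRealSolution (hq : IntegrableOn q (Icc 0 π)) (hθ : IsAngle q μ θ) :
    ∃ r : ℝ → ℝ, (∀ x, 0 < r x) ∧
      IsRealSolution q μ (fun x ↦ r x * sin (θ x)) (fun x ↦ r x * cos (θ x)) := by
  have hqi := intervalIntegrable_of_integrableOn hq
  have hθc : ContinuousOn θ (uIcc 0 π) := hθ.ac.continuousOn
  have hs : HasACDeriv (fun x ↦ sin (θ x)) _ 0 π :=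
    hθ.comp hasDerivAt_sin continuous_cos
  have hc : HasACDeriv (fun x ↦ cos (θ x)) _ 0 π :=
    hθ.comp hasDerivAt_cos continuous_sin.neg
  -- The Prüfer amplitude satisfies `r' / r = (1 + q - μ) sin θ cos θ`; taking `r` as an exponential
  -- makes it positive.
  have hi : IntervalIntegrable (fun x ↦ (1 + q x - μ) * (sin (θ x) * cos (θ x))) volume 0 π :=
    ((intervalIntegrable_const.add hqi).sub intervalIntegrable_const).mul_continuousOn
      ((continuous_sin.comp_continuousOn hθc).mul (continuous_cos.comp_continuousOn hθc))
  have hr := (HasACDeriv.primitive pi_pos.le hi).comp hasDerivAt_exp continuous_exp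
  refine ⟨_, fun x ↦ exp_pos _, (hr.mul hs).congr_deriv (.of_forall fun x _ ↦ ?_),
    (hr.mul hc).congr_deriv (.of_forall fun x _ ↦ ?_)⟩
  · generalize exp _ = E
    linear_combination (E * cos (θ x)) * sin_sq_add_cos_sq (θ x)
  · generalize exp _ = E
    linear_combination ((q x - μ) * E * sin (θ x)) * sin_sq_add_cos_sq (θ x)

/-- A solution whose initial data are proportional to those of the solution with Prüfer angle `θ`
is proportional to it. -/
theorem IsRealSolution.exists_eq_mul {u u' r : ℝ → ℝ} (hq : IntegrableOn q (Icc 0 π))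
    (hu : IsRealSolution q μ u u') (hr : ∀ x, 0 < r x)
    (hφ : IsRealSolution q μ (fun x ↦ r x * sin (θ x)) (fun x ↦ r x * cos (θ x)))
    (h0 : u 0 * cos (θ 0) - u' 0 * sin (θ 0) = 0) :
    ∃ c : ℝ, ∀ x ∈ Icc 0 π, u x = c * (r x * sin (θ x)) ∧ u' x = c * (r x * cos (θ x)) := by
  -- Shifting the initial angle by `π / 2` gives an independent solution, with Wronskian `-w ≠ 0`.
  -- Constancy of the three Wronskians then determines `u` and `u'`.
  obtain ⟨σ, hσ, hσ0⟩ := exists_isAngle hq μ (θ 0 + π / 2)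
  obtain ⟨ρ, hρ, hψ⟩ := hσ.exists_isRealSolution hq
  set w := r 0 * ρ 0 with hw
  have hwpos : 0 < w := mul_pos (hr 0) (hρ 0)
  set d := u 0 * (ρ 0 * cos (σ 0)) - u' 0 * (ρ 0 * sin (σ 0)) with hd
  refine ⟨-d / w, fun x hx ↦ ?_⟩
  have h1 := hu.wronskian_eq hφ hx
  have h2 := hu.wronskian_eq hψ hx
  have h3 := hφ.wronskian_eq hψ hx
  have h4 : r 0 * sin (θ 0) * (ρ 0 * cos (σ 0)) - r 0 * cos (θ 0) * (ρ 0 * sin (σ 0)) = -w := by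
    rw [hσ0, cos_add_pi_div_two, sin_add_pi_div_two]
    linear_combination (-r 0 * ρ 0) * sin_sq_add_cos_sq (θ 0)
  have h5 : u 0 * (r 0 * cos (θ 0)) - u' 0 * (r 0 * sin (θ 0)) = 0 := by
    linear_combination r 0 * h0
  rw [h5] at h1
  rw [h4] at h3
  rw [← hd] at h2
  constructor
  · rw [div_mul_eq_mul_div, eq_div_iff hwpos.ne']
    linear_combination (-(r x * sin (θ x))) * h2 + u x * h3 + (ρ x * sin (σ x)) * h1
  · rw [div_mul_eq_mul_div, eq_div_iff hwpos.ne']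
    linear_combination (-(r x * cos (θ x))) * h2 + u' x * h3 + (ρ x * cos (σ x)) * h1

/-! ### From complex solutions to real ones and back -/

variable {z : ℂ} {y : ℝ → ℂ}

lemma IsSolution.hasDerivWithinAt (h : IsSolution q z y) {x : ℝ} (hx : x ∈ Icc 0 π) :
    HasDerivWithinAt y (D y x) (Icc 0 π) x :=
  (h.differentiableOn x hx).hasDerivWithinAt

/-- Real-linear functionals of a complex solution. -/
lemma IsSolution.hasACDeriv_clm (h : IsSolution q z y) (ℓ : ℂ →L[ℝ] ℝ) :
    HasACDeriv (fun x ↦ ℓ (y x)) (fun x ↦ ℓ (D y x)) 0 π ∧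
      HasACDeriv (fun x ↦ ℓ (D y x)) (fun x ↦ ℓ ((q x - z) * y x)) 0 π := by
  have hac := h.absCont.comp_lipschitzOnWith (ℓ.lipschitz.lipschitzOnWith (s := univ))
    (mapsTo_univ _ _)
  refine ⟨.of_continuousOn pi_pos.le (fun x hx ↦ ?_) ?_, hac, ?_⟩
  · exact ℓ.hasFDerivAt.comp_hasDerivWithinAt x (h.hasDerivWithinAt hx)
  · simpa [uIcc_of_le pi_pos.le] using hac.continuousOn
  · filter_upwards [h.eqn] with x hx hx'
    obtain ⟨y'', h1, h2⟩ := hx hx'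
    have h3 : y'' = (q x - z) * y x := by linear_combination -h2
    rw [← h3]
    exact ℓ.hasFDerivAt.comp_hasDerivAt x h1

lemma IsSolution.isRealSolution_re (h : IsSolution q μ y) :
    IsRealSolution q μ (fun x ↦ (y x).re) (fun x ↦ (D y x).re) := by
  obtain ⟨h1, h2⟩ := h.hasACDeriv_clm Complex.reCLM
  exact ⟨h1, h2.congr_deriv (.of_forall fun x _ ↦ by simp)⟩

lemma IsSolution.isRealSolution_im (h : IsSolution q μ y) :
    IsRealSolution q μ (fun x ↦ (y x).im) (fun x ↦ (D y x).im) := by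
  obtain ⟨h1, h2⟩ := h.hasACDeriv_clm Complex.imCLM
  exact ⟨h1, h2.congr_deriv (.of_forall fun x _ ↦ by simp)⟩

lemma IsRealSolution.isSolution {u u' : ℝ → ℝ} (h : IsRealSolution q μ u u') :
    IsSolution q μ (fun x ↦ (u x : ℂ)) ∧
      EqOn (D fun x ↦ (u x : ℂ)) (fun x ↦ (u' x : ℂ)) (Icc 0 π) := by
  have hd : ∀ x ∈ Icc 0 π, HasDerivWithinAt (fun x ↦ (u x : ℂ)) (u' x : ℂ) (Icc 0 π) x :=
    fun x hx ↦ (h.left.hasDerivWithinAt (h.right.continuousOn pi_pos.le) hx).ofReal_comp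
  have hD : EqOn (D fun x ↦ (u x : ℂ)) (fun x ↦ (u' x : ℂ)) (Icc 0 π) := fun x hx ↦
    (hd x hx).derivWithin (uniqueDiffOn_Icc pi_pos x hx)
  refine ⟨⟨fun x hx ↦ (hd x hx).differentiableWithinAt, ?_, ?_⟩, hD⟩
  · refine (h.right.ac.comp_lipschitzOnWith
      (Complex.isometry_ofReal.lipschitz.lipschitzOnWith (s := univ)) (mapsTo_univ _ _)).congr ?_
    rw [uIcc_of_le pi_pos.le]
    exact hD.symm
  · filter_upwards [h.right.ae_hasDerivAt] with x hx hx'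
    refine ⟨_, (hx hx').ofReal_comp.congr_of_eventuallyEq ?_, ?_⟩
    · filter_upwards [isOpen_Ioo.mem_nhds hx'] with t ht using hD (Ioo_subset_Icc_self ht)
    · push_cast; ring

/-- Both data vectors are orthogonal to the nonzero vector `(cos a, sin a)`, hence are dependent. -/
lemma wronskian_eq_zero_of_boundary {a u u' v v' : ℝ} (hu : u * cos a + u' * sin a = 0)
    (hv : v * cos a + v' * sin a = 0) : u * v' - u' * v = 0 := by
  linear_combination (cos a * v' - sin a * v) * hu + (sin a * u - cos a * u') * hv -
    (u * v' - u' * v) * sin_sq_add_cos_sq a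

lemma boundary_re_im {a : ℝ} {w w' : ℂ} (h : w * (cos a : ℂ) + w' * (sin a : ℂ) = 0) :
    w.re * cos a + w'.re * sin a = 0 ∧ w.im * cos a + w'.im * sin a = 0 := by
  have h1 := congrArg Complex.re h
  have h2 := congrArg Complex.im h
  simp only [Complex.add_re, Complex.add_im, Complex.re_mul_ofReal, Complex.im_mul_ofReal,
    Complex.zero_re, Complex.zero_im] at h1 h2
  exact ⟨h1, h2⟩

/-! ### Eigenvalues and eigenfunctions through the angle -/

variable {α β : ℝ}

/-- Eigenvalues are real. -/
theorem IsEigenfunction.im_eq_zero (h : IsEigenfunction q α β z y) : z.im = 0 := by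
  obtain ⟨hu, hu'⟩ := h.isSolution.hasACDeriv_clm Complex.reCLM
  obtain ⟨hv, hv'⟩ := h.isSolution.hasACDeriv_clm Complex.imCLM
  simp only [Complex.reCLM_apply, Complex.imCLM_apply] at hu hu' hv hv'
  -- The Wronskian of `re y` and `im y` has derivative `-(im z) |y|²` and vanishes at both ends.
  have hW := ((hu.mul hv').sub (hu'.mul hv)).congr_deriv
    (g' := fun x ↦ -z.im * ((y x).re ^ 2 + (y x).im ^ 2)) (.of_forall fun x _ ↦ by
      simp only [Complex.mul_re, Complex.mul_im, Complex.sub_re, Complex.sub_im,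
        Complex.ofReal_re, Complex.ofReal_im]
      ring)
  have h1 := hW.integral_eq pi_pos.le
  have hl := boundary_re_im h.left
  have hr := boundary_re_im h.right
  rw [wronskian_eq_zero_of_boundary hl.1 hl.2, wronskian_eq_zero_of_boundary hr.1 hr.2,
    intervalIntegral.integral_const_mul, sub_zero, mul_eq_zero] at h1
  obtain ⟨x, hx, hx0⟩ := h.nontrivial
  have h2 : 0 < ∫ x in (0 : ℝ)..π, ((y x).re ^ 2 + (y x).im ^ 2) := by
    refine intervalIntegral.integral_pos pi_pos
      (((hu.continuousOn pi_pos.le).pow 2).add ((hv.continuousOn pi_pos.le).pow 2))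
      (fun x _ ↦ by positivity) ⟨x, hx, ?_⟩
    have := Complex.normSq_pos.2 hx0
    rw [Complex.normSq_apply] at this
    nlinarith
  have h3 := h1.resolve_right h2.ne'
  linarith

/-- Every eigenfunction is a nonzero multiple of the solution with the Prüfer angle that fits the
left boundary condition. -/
theorem IsEigenfunction.exists_polar (hq : IntegrableOn q (Icc 0 π))
    (h : IsEigenfunction q α β μ y) (hθ : IsAngle q μ θ) (h0 : θ 0 = π - α) :
    ∃ (C : ℂ) (r : ℝ → ℝ), C ≠ 0 ∧ (∀ x, 0 < r x) ∧ ∀ x ∈ Icc 0 π,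
      y x = C * (r x * sin (θ x) : ℝ) ∧ D y x = C * (r x * cos (θ x) : ℝ) := by
  obtain ⟨r, hr, hφ⟩ := hθ.exists_isRealSolution hq
  have hl := boundary_re_im h.left
  obtain ⟨c₁, h₁⟩ := h.isSolution.isRealSolution_re.exists_eq_mul hq hr hφ (by
    rw [h0, cos_pi_sub, sin_pi_sub]; linear_combination -hl.1)
  obtain ⟨c₂, h₂⟩ := h.isSolution.isRealSolution_im.exists_eq_mul hq hr hφ (by
    rw [h0, cos_pi_sub, sin_pi_sub]; linear_combination -hl.2)
  have hy : ∀ x ∈ Icc 0 π, y x = (⟨c₁, c₂⟩ : ℂ) * (r x * sin (θ x) : ℝ) ∧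
      D y x = (⟨c₁, c₂⟩ : ℂ) * (r x * cos (θ x) : ℝ) := fun x hx ↦ by
    constructor
    · apply Complex.ext
      · rw [Complex.re_mul_ofReal]; exact (h₁ x hx).1
      · rw [Complex.im_mul_ofReal]; exact (h₂ x hx).1
    · apply Complex.ext
      · rw [Complex.re_mul_ofReal]; exact (h₁ x hx).2
      · rw [Complex.im_mul_ofReal]; exact (h₂ x hx).2
  refine ⟨⟨c₁, c₂⟩, r, fun hC ↦ ?_, hr, hy⟩
  obtain ⟨x, hx, hx0⟩ := h.nontrivial
  rw [(hy x hx).1, hC, zero_mul] at hx0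
  exact hx0 rfl

/-- The characteristic equation in terms of the terminal Prüfer angle. -/
theorem isEigenvalue_iff_sin_eq_zero (hq : IntegrableOn q (Icc 0 π)) (hθ : IsAngle q μ θ)
    (h0 : θ 0 = π - α) : IsEigenvalue q α β μ ↔ sin (θ π + β) = 0 := by
  have hπ : π ∈ Icc 0 π := ⟨pi_pos.le, le_rfl⟩
  constructor
  · rintro ⟨y, hy⟩
    obtain ⟨C, r, hC, hr, h⟩ := hy.exists_polar hq hθ h0
    have h1 := hy.right
    rw [(h π hπ).1, (h π hπ).2] at h1
    have h2 : C * ((r π * sin (θ π + β) : ℝ) : ℂ) = 0 := by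
      rw [← h1, sin_add]; push_cast; ring
    rw [mul_eq_zero, Complex.ofReal_eq_zero, mul_eq_zero] at h2
    exact (h2.resolve_left hC).resolve_left (hr π).ne'
  · intro h
    obtain ⟨r, hr, hφ⟩ := hθ.exists_isRealSolution hq
    obtain ⟨hs, hD⟩ := hφ.isSolution
    refine ⟨_, hs, ?_, ?_, ?_⟩
    · rw [hD ⟨le_rfl, pi_pos.le⟩]
      simp only [h0, sin_pi_sub, cos_pi_sub]
      push_cast; ring
    · rw [hD hπ]
      have : ((r π * sin (θ π + β) : ℝ) : ℂ) = 0 := by rw [h]; simp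
      rw [← this, sin_add]; push_cast; ring
    · obtain ⟨x, hx, hx0⟩ := hθ.not_sin_eq_zero
      exact ⟨x, hx, by
        rw [Complex.ofReal_ne_zero]; exact mul_ne_zero (hr x).ne' hx0⟩

/-! ### Counting zeros and indexing the spectrum -/

/-- The number of interior points at which the angle is a multiple of `π`. -/
theorem IsAngle.encard_sin_eq_zero (hq : IntegrableOn q (Icc 0 π)) (hθ : IsAngle q μ θ)
    (h0 : θ 0 ∈ Ico 0 π) {n : ℕ} (hn : θ π ∈ Ioc (n * π) ((n + 1) * π)) :
    {x ∈ Ioo 0 π | sin (θ x) = 0}.encard = n := by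
  have hpi := pi_pos
  have hinj : InjOn θ {x ∈ Ioo 0 π | sin (θ x) = 0} := by
    -- The angle need not increase everywhere, but from a multiple of `π` it only moves to larger
    -- values.
    have key : ∀ x ∈ {x ∈ Ioo 0 π | sin (θ x) = 0}, ∀ x' ∈ Ioo 0 π, x < x' → θ x < θ x' := by
      rintro x ⟨hx, hx0⟩ x' hx' hlt
      obtain ⟨m, hm⟩ := sin_eq_zero_iff.1 hx0
      rw [← hm]
      exact hθ.lt_of_le hq m hx.1.le hlt hx'.2.le hm.le
    intro x hx x' hx' heq
    rcases lt_trichotomy x x' with h | h | h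
    · exact absurd heq (key x hx x' hx'.1 h).ne
    · exact h
    · exact absurd heq (key x' hx' x hx.1 h).ne'
  have himg : θ '' {x ∈ Ioo 0 π | sin (θ x) = 0} =
      (fun k : ℕ ↦ (k : ℝ) * π) '' (Finset.Icc 1 n : Set ℕ) := by
    ext t
    simp only [mem_image, Finset.coe_Icc]
    constructor
    · rintro ⟨x, ⟨hx, hx0⟩, rfl⟩
      obtain ⟨m, hm⟩ := sin_eq_zero_iff.1 hx0
      have h1 : 0 < θ x := by
        simpa using hθ.lt_of_le hq 0 le_rfl hx.1 hx.2.le (by simpa using h0.1)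
      have h2 : 0 < m := by
        rw [← hm] at h1
        exact_mod_cast pos_of_mul_pos_left h1 hpi.le
      -- A multiple met in the interior is strictly exceeded at `π`; this excludes `m = n + 1` even
      -- when `θ π = (n + 1) π`.
      have h3 : m ≤ n := by
        by_contra! hcon
        have h4 : (n + 1 : ℝ) ≤ m := by exact_mod_cast hcon
        have h5 := hθ.lt_of_le hq m hx.1.le hx.2 le_rfl hm.le
        have h6 := mul_le_mul_of_nonneg_right h4 hpi.le
        linarith [hn.2]
      lift m to ℕ using h2.le
      exact ⟨m, ⟨by omega, by omega⟩, by simpa using hm⟩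
    · rintro ⟨k, hk, rfl⟩
      have h1 : (1 : ℝ) ≤ k := by exact_mod_cast hk.1
      have h2 : (k : ℝ) ≤ n := by exact_mod_cast hk.2
      obtain ⟨x, hx, hxk⟩ := intermediate_value_Ioo hpi.le (hθ.continuousOn hpi.le)
        (show (k : ℝ) * π ∈ Ioo (θ 0) (θ π) from
          ⟨by nlinarith [h0.2], by nlinarith [hn.1]⟩)
      exact ⟨x, ⟨hx, by rw [hxk, sin_nat_mul_pi]⟩, hxk⟩
  rw [← hinj.encard_image, himg, Function.Injective.encard_image, encard_coe_eq_coe_finsetCard]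
  · simp
  · intro a b hab
    simpa [hpi.ne'] using hab

/-- With `β ∈ [0, π)` and a positive angle, the characteristic equation singles out the levels
`(n + 1) π - β`. -/
lemma sin_add_eq_zero_iff_exists_nat {t : ℝ} (ht : 0 < t) (hβ : 0 ≤ β) :
    sin (t + β) = 0 ↔ ∃ n : ℕ, t = (n + 1) * π - β := by
  rw [sin_eq_zero_iff]
  constructor
  · rintro ⟨m, hm⟩
    have h1 : 0 < m := by
      have : 0 < (m : ℝ) * π := by linarith
      exact_mod_cast pos_of_mul_pos_left this pi_pos.le
    lift m to ℕ using h1.le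
    -- Since `t > 0` and `β ≥ 0` force `m ≥ 1`, the levels are indexed from `0`.
    refine ⟨m - 1, ?_⟩
    rw [Nat.cast_sub (by omega)]
    push_cast at hm ⊢
    linarith
  · rintro ⟨n, rfl⟩
    exact ⟨n + 1, by push_cast; ring⟩

/-- The enumerations of the spectrum are the sequences at which the terminal angle takes the
values `(n + 1) π - β`. -/
theorem IsAngleFamily.isEigenvalueEnumeration_iff (hq : IntegrableOn q (Icc 0 π))
    (hα : α ∈ Ioc 0 π) (hβ : β ∈ Ico 0 π) {Θ : ℝ → ℝ → ℝ} (hΘ : IsAngleFamily q (π - α) Θ)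
    (m : ℕ → ℝ) :
    IsEigenvalueEnumeration q α β m ↔ ∀ n : ℕ, Θ (m n) π = (n + 1) * π - β := by
  have hc : 0 ≤ π - α := sub_nonneg.2 hα.2
  have hmono := hΘ.strictMono hq
  have hreal : ∀ x : ℝ, IsEigenvalue q α β x ↔ ∃ n : ℕ, Θ x π = (n + 1) * π - β := fun x ↦ by
    rw [isEigenvalue_iff_sin_eq_zero hq (hΘ.isAngle x) (hΘ.initial x),
      sin_add_eq_zero_iff_exists_nat (hΘ.pos hq hc x) hβ.1]
  have hsuff : ∀ m : ℕ → ℝ, (∀ n : ℕ, Θ (m n) π = (n + 1) * π - β) →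
      IsEigenvalueEnumeration q α β m := fun m hm ↦ by
    refine ⟨fun i j hij ↦ ?_, fun z ↦ ⟨?_, ?_⟩⟩
    · rw [← hmono.lt_iff_lt]
      simp only [hm]
      have : (i : ℝ) < j := by exact_mod_cast hij
      nlinarith [pi_pos]
    · rintro ⟨y, hy⟩
      obtain ⟨x, rfl⟩ : ∃ x : ℝ, z = x := ⟨z.re, Complex.ext rfl hy.im_eq_zero⟩
      obtain ⟨n, hn⟩ := (hreal x).1 ⟨y, hy⟩
      exact ⟨n, congrArg _ (hmono.injective (hn.trans (hm n).symm))⟩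
    · rintro ⟨n, rfl⟩
      exact (hreal _).2 ⟨n, hm n⟩
  refine ⟨fun hm ↦ ?_, hsuff m⟩
  choose m₀ hm₀ using fun n : ℕ ↦ hΘ.exists_eq hq (sub_lt_self π hα.1)
    (show 0 < (n + 1) * π - β by nlinarith [pi_pos, hβ.2, (Nat.cast_nonneg n : (0 : ℝ) ≤ n)])
  have h0 := hsuff m₀ hm₀
  -- Both sequences increase strictly and have the spectrum as range, so they coincide.
  have heq : m = m₀ := by
    rw [← hm.strictMono.range_inj h0.strictMono]
    ext x
    have h1 := hm.isEigenvalue_iff x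
    rw [h0.isEigenvalue_iff x] at h1
    simpa [eq_comm] using h1.symm
  rw [heq]
  exact hm₀

end SturmLiouville
end

/-! ### The oscillation theorem -/

theorem theorem1 (q : ℝ → ℝ) (hq : IntegrableOn q (Icc 0 π)) (α β : ℝ)
    (hα : α ∈ Ioc 0 π) (hβ : β ∈ Ico 0 π) :
    (∃! μ : ℕ → ℝ, SturmLiouville.IsEigenvalueEnumeration q α β μ) ∧
    ∀ μ : ℕ → ℝ, SturmLiouville.IsEigenvalueEnumeration q α β μ →
      ∀ (n : ℕ) (y : ℝ → ℂ), SturmLiouville.IsEigenfunction q α β (μ n : ℂ) y →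
        (SturmLiouville.zeros y (Ioo 0 π)).encard = (n : ℕ∞) ∧
        (∀ x ∈ SturmLiouville.zeros y (Ioo 0 π), deriv y x ≠ 0) ∧
        (α = π → β = 0 →
          (SturmLiouville.zeros y (Icc 0 π)).encard = (n : ℕ∞) + 2) ∧
        ((α = π ∧ β ∈ Ioo 0 π) ∨ (β = 0 ∧ α ∈ Ioo 0 π) →
          (SturmLiouville.zeros y (Icc 0 π)).encard = (n : ℕ∞) + 1) := by
  have hpi := pi_pos
  obtain ⟨Θ, hΘ⟩ := SturmLiouville.exists_isAngleFamily hq (π - α)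
  have hiff := hΘ.isEigenvalueEnumeration_iff hq hα hβ
  refine ⟨?_, fun μ hμ n y hy ↦ ?_⟩
  · choose m hm using fun n : ℕ ↦ hΘ.exists_eq hq (sub_lt_self π hα.1)
      (show 0 < (n + 1) * π - β by nlinarith [hβ.2, (Nat.cast_nonneg n : (0 : ℝ) ≤ n)])
    refine ⟨m, (hiff m).2 hm, fun m' hm' ↦ funext fun n ↦ (hΘ.strictMono hq).injective ?_⟩
    exact ((hiff m').1 hm' n).trans (hm n).symm
  have hn := (hiff μ).1 hμ n
  have h0 := hΘ.initial (μ n)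
  obtain ⟨C, r, hC, hr, hyx⟩ := hy.exists_polar hq (hΘ.isAngle _) h0
  have hθ := hΘ.isAngle (μ n)
  generalize Θ (μ n) = θ at hn h0 hyx hθ
  have hzero : ∀ x ∈ Icc 0 π, (y x = 0 ↔ sin (θ x) = 0) := fun x hx ↦ by
    rw [(hyx x hx).1, mul_eq_zero, or_iff_right hC, Complex.ofReal_eq_zero, mul_eq_zero,
      or_iff_right (hr x).ne']
  have hzero0 : y 0 = 0 ↔ sin α = 0 := by
    rw [hzero 0 ⟨le_rfl, hpi.le⟩, h0, sin_pi_sub]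
  have hzeroπ : y π = 0 ↔ sin β = 0 := by
    -- Up to sign, `sin (θ π)` is `sin (π - β) = sin β`.
    rw [hzero π ⟨hpi.le, le_rfl⟩, hn, show (n + 1) * π - β = n * π + (π - β) by ring,
      add_comm, sin_add_nat_mul_pi, sin_pi_sub]
    simp
  have hcount : (SturmLiouville.zeros y (Ioo 0 π)).encard = (n : ℕ∞) := by
    rw [← hθ.encard_sin_eq_zero hq (n := n)
      ⟨by rw [h0]; linarith [hα.2], by rw [h0]; linarith [hα.1]⟩
      ⟨by rw [hn]; linarith [hβ.2], by rw [hn]; linarith [hβ.1]⟩]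
    congr 1
    ext x
    exact and_congr_right fun hx ↦ hzero x (Ioo_subset_Icc_self hx)
  have hnot0 : (0 : ℝ) ∉ SturmLiouville.zeros y (Ioo 0 π) := fun h ↦ lt_irrefl _ h.1.1
  have hnotπ : π ∉ SturmLiouville.zeros y (Ioo 0 π) := fun h ↦ lt_irrefl _ h.1.2
  have hmem : ∀ x, x ∈ Icc 0 π ↔ x = 0 ∨ x = π ∨ x ∈ Ioo 0 π := fun x ↦ by
    rw [← Ioo_union_both hpi.le]
    simp only [mem_union, mem_insert_iff, mem_singleton_iff]
    tauto
  refine ⟨hcount, ?_, ?_, ?_⟩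
  · rintro x ⟨hx, hx0⟩
    have hx' := Ioo_subset_Icc_self hx
    rw [← derivWithin_of_mem_nhds (Icc_mem_nhds hx.1 hx.2)]
    change SturmLiouville.D y x ≠ 0
    have hs := (hzero x hx').1 hx0
    rw [(hyx x hx').2]
    refine mul_ne_zero hC (Complex.ofReal_ne_zero.2 (mul_ne_zero (hr x).ne' fun hc ↦ ?_))
    have := sin_sq_add_cos_sq (θ x)
    rw [hs, hc] at this
    norm_num at this
  · rintro rfl rfl
    have hZ : SturmLiouville.zeros y (Icc 0 π) =
        insert 0 (insert π (SturmLiouville.zeros y (Ioo 0 π))) := by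
      ext x
      simp only [SturmLiouville.zeros, mem_ofPred_eq, mem_insert_iff, hmem]
      constructor
      · tauto
      · rintro (rfl | rfl | h)
        · exact ⟨Or.inl rfl, hzero0.2 sin_pi⟩
        · exact ⟨Or.inr (Or.inl rfl), hzeroπ.2 sin_zero⟩
        · exact ⟨Or.inr (Or.inr h.1), h.2⟩
    rw [hZ, encard_insert_of_notMem (by simp [hnot0, hpi.ne]), encard_insert_of_notMem hnotπ,
      hcount, add_assoc, one_add_one_eq_two]
  · rintro (⟨rfl, hβ'⟩ | ⟨rfl, hα'⟩)
    · have hZ : SturmLiouville.zeros y (Icc 0 π) =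
          insert 0 (SturmLiouville.zeros y (Ioo 0 π)) := by
        ext x
        simp only [SturmLiouville.zeros, mem_ofPred_eq, mem_insert_iff, hmem]
        constructor
        · rintro ⟨h | rfl | h, h'⟩
          · exact Or.inl h
          · exact absurd (hzeroπ.1 h') (sin_pos_of_mem_Ioo hβ').ne'
          · exact Or.inr ⟨h, h'⟩
        · rintro (rfl | h)
          · exact ⟨Or.inl rfl, hzero0.2 sin_pi⟩
          · exact ⟨Or.inr (Or.inr h.1), h.2⟩
      rw [hZ, encard_insert_of_notMem hnot0, hcount]
    · have hZ : SturmLiouville.zeros y (Icc 0 π) =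
          insert π (SturmLiouville.zeros y (Ioo 0 π)) := by
        ext x
        simp only [SturmLiouville.zeros, mem_ofPred_eq, mem_insert_iff, hmem]
        constructor
        · rintro ⟨rfl | h | h, h'⟩
          · exact absurd (hzero0.1 h') (sin_pos_of_mem_Ioo hα').ne'
          · exact Or.inl h
          · exact Or.inr ⟨h, h'⟩
        · rintro (rfl | h)
          · exact ⟨Or.inr (Or.inl rfl), hzeroπ.2 sin_zero⟩
          · exact ⟨Or.inr (Or.inr h.1), h.2⟩
      rw [hZ, encard_insert_of_notMem hnotπ, hcount]
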